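/- For a finite simple graph $G$ on $n$ vertices let $I(G,z)=\sum_{k=0}^{n}(-1)^k a_k(G)z^k$ be its independence polynomial, where $a_k(G)$ is the number of independent sets of $G$ of size $k$. There is an absolute constant $c\in\mathbb{N}$ such that for every $n\ge 1$ and every connected simple graph $G$ on $n$ vertices, the polynomial $I(G,z)$ has a smallest real root $\beta(G)$, and the open disc $$D\!\left(0,\ \beta(G)+\left(\frac{\beta(G)}{n}\right)^{c\,n}\right)\subset\mathbb{C}$$ contains $\beta(G)$ and no other complex root of $I(G,z)$. -/

import Mathlib

open Polynomial

universe u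

namespace SimpleGraph

variable {V : Type u} [Fintype V]

/-- `a_k(G)`: the number of independent sets of size `k` of the graph `G`. -/
noncomputable def numIndepSets (G : SimpleGraph V) (k : ℕ) : ℕ :=
  {s : Finset V | G.IsNIndepSet k s}.ncard

/-- The independence polynomial `I(G, z) = ∑_{k=0}^n (-1)^k a_k(G) z^k` of a graph on `n` vertices,
with the alternating sign convention. -/
noncomputable def indepPoly (G : SimpleGraph V) : ℤ[X] :=
  ∑ k ∈ Finset.range (Fintype.card V + 1), C ((-1) ^ k * (G.numIndepSets k : ℤ)) * X ^ k

/-- `β(G)`: the smallest real root of the independence polynomial (the infimum of the finite set of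
its real roots). -/
noncomputable def smallestRoot (G : SimpleGraph V) : ℝ :=
  sInf {x : ℝ | aeval x G.indepPoly = 0}

end SimpleGraph

/-!
Deleting a vertex gives `I(G, z) = I(G - v, z) - z I(G - N[v], z)`. As long as all induced
subgraphs of `G[A]` have a positive independence polynomial at `r`, the ratios
`I(G[B], z) / I(G[A], z)` with `B ⊆ A` behave on the disc `‖z‖ ≤ r` like power series with
nonnegative coefficients: they are dominated by their values at `r`. A root `z` of `I(G, z)` is a
solution of `z * I(G - N[v], z) / I(G - v, z) = 1`, so if `‖z‖` is close to `β = β(G)`, then the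
triangle inequality is almost an equality, and the coefficient of `z ^ 2` forces `z` to be close
to the positive axis, hence to `β`.

On the other hand, connectedness gives `I(G[B], β) ≥ β ^ n` for every proper vertex subset `B`, so
that `|I'(G, β)| ≥ β ^ n`. As second divided differences of `I(G, z)` are at most `n ^ 2 * 2 ^ n`
on the unit disc, any other root there has distance at least `q = β ^ n / (n ^ 2 * 2 ^ n)` from
`β`. Together the two estimates exclude further roots of modulus less than
`β + q ^ 3 / 32 ≥ β + (β / n) ^ (11 n)`.
-/

section NormedRing

variable {R : Type*}

theorem norm_le_of_norm_sub_one_le [SeminormedRing R] [NormOneClass R] {a : R} {x : ℝ}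
    (h : ‖a - 1‖ ≤ x - 1) : ‖a‖ ≤ x := by
  have := norm_add_le (a - 1) 1
  rw [sub_add_cancel, norm_one] at this
  linarith

theorem norm_mul_sub_one_le [SeminormedRing R] {a b : R} {x y : ℝ}
    (ha : ‖a - 1‖ ≤ x - 1) (hb : ‖b - 1‖ ≤ y - 1) : ‖a * b - 1‖ ≤ x * y - 1 :=
  calc ‖a * b - 1‖ = ‖(a - 1) * (b - 1) + (a - 1) + (b - 1)‖ := by congr 1; noncomm_ring
    _ ≤ ‖a - 1‖ * ‖b - 1‖ + ‖a - 1‖ + ‖b - 1‖ :=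
      norm_add₃_le.trans (by gcongr; exact norm_mul_le _ _)
    _ ≤ (x - 1) * (y - 1) + (x - 1) + (y - 1) := by
      gcongr
      exact (norm_nonneg _).trans ha
    _ = x * y - 1 := by ring

theorem one_sub_ne_zero_of_norm_le [SeminormedRing R] [NormOneClass R] {w : R} {x : ℝ}
    (hw : ‖w‖ ≤ x) (hx : x < 1) : 1 - w ≠ 0 := by
  intro h
  rw [← sub_eq_zero.1 h, norm_one] at hw
  exact hx.not_ge hw

theorem norm_inv_one_sub_sub_one_le {𝕜 : Type*} [NormedField 𝕜] {w : 𝕜} {x : ℝ}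
    (hw : ‖w‖ ≤ x) (hx : x < 1) : ‖(1 - w)⁻¹ - 1‖ ≤ (1 - x)⁻¹ - 1 := by
  have hw1 : 1 - w ≠ 0 := one_sub_ne_zero_of_norm_le hw hx
  have hx1 : 0 < 1 - x := sub_pos.2 hx
  have hle : 1 - x ≤ ‖1 - w‖ := by
    have := norm_sub_norm_le (1 : 𝕜) w
    rw [norm_one] at this
    linarith
  calc ‖(1 - w)⁻¹ - 1‖ = ‖w‖ * ‖1 - w‖⁻¹ := by
        rw [← norm_inv, ← norm_mul]; congr 1; field_simp; ring
    _ ≤ x * (1 - x)⁻¹ := by gcongr; exact (norm_nonneg w).trans hw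
    _ = (1 - x)⁻¹ - 1 := by field_simp; ring

variable [SeminormedCommRing R] [NormOneClass R] {a b c : R}

theorem norm_pow_sub_pow_le (ha : ‖a‖ ≤ 1) (hb : ‖b‖ ≤ 1) (k : ℕ) :
    ‖a ^ k - b ^ k‖ ≤ k * ‖a - b‖ := by
  induction k with
  | zero => simp
  | succ k ih =>
    have hak : ‖a ^ k‖ ≤ 1 := (norm_pow_le a k).trans (pow_le_one₀ (norm_nonneg a) ha)
    calc ‖a ^ (k + 1) - b ^ (k + 1)‖ = ‖a ^ k * (a - b) + (a ^ k - b ^ k) * b‖ := by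
          congr 1; ring
      _ ≤ ‖a ^ k‖ * ‖a - b‖ + ‖a ^ k - b ^ k‖ * ‖b‖ :=
        (norm_add_le _ _).trans (add_le_add (norm_mul_le _ _) (norm_mul_le _ _))
      _ ≤ 1 * ‖a - b‖ + k * ‖a - b‖ * 1 := by gcongr
      _ = (k + 1 : ℕ) * ‖a - b‖ := by push_cast; ring

/-- Dividing by the three differences, this bounds the second divided difference of `x ^ k`. -/
theorem norm_pow_three_point_le (ha : ‖a‖ ≤ 1) (hb : ‖b‖ ≤ 1) (hc : ‖c‖ ≤ 1) (k : ℕ) :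
    ‖(a ^ k - c ^ k) * (b - c) - (b ^ k - c ^ k) * (a - c)‖ ≤
      k ^ 2 * (‖a - b‖ * ‖a - c‖ * ‖b - c‖) := by
  induction k with
  | zero => simp
  | succ k ih =>
    set D := (a ^ k - c ^ k) * (b - c) - (b ^ k - c ^ k) * (a - c) with hD
    set p := ‖a - b‖ * ‖a - c‖ * ‖b - c‖
    have : 0 ≤ p := by positivity
    calc ‖(a ^ (k + 1) - c ^ (k + 1)) * (b - c) - (b ^ (k + 1) - c ^ (k + 1)) * (a - c)‖
        = ‖c * D + (a ^ k - b ^ k) * (a - c) * (b - c)‖ := by rw [hD]; congr 1; ring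
      _ ≤ ‖c‖ * ‖D‖ + ‖a ^ k - b ^ k‖ * ‖a - c‖ * ‖b - c‖ :=
        (norm_add_le _ _).trans (add_le_add (norm_mul_le _ _) norm_mul₃_le)
      _ ≤ 1 * (k ^ 2 * p) + k * ‖a - b‖ * ‖a - c‖ * ‖b - c‖ := by
        gcongr
        exact norm_pow_sub_pow_le ha hb k
      _ = (k ^ 2 + k) * p := by ring
      _ ≤ (k + 1 : ℕ) ^ 2 * p := by
        gcongr
        push_cast
        nlinarith [k.cast_nonneg (α := ℝ)]

end NormedRing

theorem nonneg_of_continuous_of_forall_lt {f : ℝ → ℝ} (hf : Continuous f) {x : ℝ}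
    (h : ∀ s < x, 0 < f s) : 0 ≤ f x :=
  closure_minimal (s := Set.Iio x) (fun s hs => (h s hs).le) (isClosed_le continuous_const hf)
    (by simp)

theorem exists_first_zero_of_continuous {f : ℝ → ℝ} (hf : Continuous f) {a t : ℝ}
    (ha : ∀ s ≤ a, 0 < f s) (ht : f t ≤ 0) :
    ∃ m ∈ Set.Ioc a t, f m = 0 ∧ ∀ s < m, 0 < f s := by
  set S : Set ℝ := {s | f s ≤ 0}
  have hlb : a ∈ lowerBounds S := fun s hs => le_of_not_ge fun h => (ha s h).not_ge hs
  have hmem : sInf S ∈ S := (isClosed_le hf continuous_const).csInf_mem ⟨t, ht⟩ ⟨a, hlb⟩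
  have hpos : ∀ s < sInf S, 0 < f s := fun s hs => lt_of_not_ge fun h =>
    hs.not_ge (csInf_le ⟨a, hlb⟩ h)
  refine ⟨sInf S, ⟨lt_of_not_ge fun h => (ha _ h).not_ge hmem, csInf_le ⟨a, hlb⟩ ht⟩, ?_, hpos⟩
  exact le_antisymm hmem (nonneg_of_continuous_of_forall_lt hf hpos)

theorem norm_sub_norm_sq_div_le (z : ℂ) :
    ‖z - ‖z‖‖ ^ 2 / (2 * (1 + ‖z‖)) ≤ ‖z‖ * (1 + ‖z‖ - ‖1 + z‖) := by
  have hfactor : ‖z - ‖z‖‖ ^ 2 = ‖z‖ * (1 + ‖z‖ - ‖1 + z‖) * (1 + ‖z‖ + ‖1 + z‖) := by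
    have h0 : ‖z‖ ^ 2 = z.re ^ 2 + z.im ^ 2 := by
      rw [Complex.sq_norm, Complex.normSq_apply]; ring
    have h1 : ‖1 + z‖ ^ 2 = (1 + z.re) ^ 2 + z.im ^ 2 := by
      rw [Complex.sq_norm, Complex.normSq_apply]
      simp only [Complex.add_re, Complex.one_re, Complex.add_im, Complex.one_im, zero_add]
      ring
    have h2 : ‖z - ‖z‖‖ ^ 2 = (z.re - ‖z‖) ^ 2 + z.im ^ 2 := by
      rw [Complex.sq_norm, Complex.normSq_apply]
      simp only [Complex.sub_re, Complex.ofReal_re, Complex.sub_im, Complex.ofReal_im, sub_zero]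
      ring
    linear_combination h2 + ‖z‖ * h1 - (‖z‖ + 1) * h0
  have hle : ‖1 + z‖ ≤ 1 + ‖z‖ := by simpa using norm_add_le 1 z
  rw [div_le_iff₀ (by positivity), hfactor]
  have : 0 ≤ ‖z‖ * (1 + ‖z‖ - ‖1 + z‖) := mul_nonneg (norm_nonneg z) (sub_nonneg.2 hle)
  gcongr
  linarith

theorem div_pow_le_cube_div {b : ℝ} {n : ℕ} (hb0 : 0 ≤ b) (hb : b ≤ 1 / 2) (hn : 2 ≤ n) :
    (b / n) ^ (11 * n) ≤ (b ^ n / (n ^ 2 * 2 ^ n)) ^ 3 / 32 := by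
  have hn' : (2 : ℝ) ≤ n := by exact_mod_cast hn
  have he0 : 0 ≤ b / n := by positivity
  have he : b / n ≤ 1 / 4 := by
    rw [div_le_iff₀ (by linarith)]
    linarith
  set t := (b / n) ^ n with ht
  have : 0 ≤ t := by positivity
  have hte : t ≤ (b / n) ^ 2 := pow_le_pow_of_le_one he0 (by linarith) hn
  have htb : t ≤ b ^ n := pow_le_pow_left₀ he0 (div_le_self hb0 (by linarith)) n
  have h2t : 2 ^ n * t ≤ 1 := by
    rw [ht, ← mul_pow]
    exact pow_le_one₀ (by positivity) (by linarith)
  have hnt : (n : ℝ) ^ 2 * t ≤ 1 :=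
    calc (n : ℝ) ^ 2 * t ≤ n ^ 2 * (b / n) ^ 2 := by gcongr
      _ = b ^ 2 := by rw [← mul_pow, mul_div_cancel₀ b (by positivity)]
      _ ≤ 1 := pow_le_one₀ hb0 (by linarith)
  have hcube : t ^ 3 ≤ b ^ n / (n ^ 2 * 2 ^ n) := by
    rw [le_div_iff₀ (by positivity)]
    calc t ^ 3 * (n ^ 2 * 2 ^ n) = (n ^ 2 * t) * (2 ^ n * t) * t := by ring
      _ ≤ 1 * 1 * b ^ n := by gcongr
      _ = b ^ n := by ring
  have ht16 : t ≤ 1 / 16 := hte.trans (by nlinarith)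
  calc (b / n) ^ (11 * n) = t ^ 11 := by rw [ht, ← pow_mul, mul_comm]
    _ = (t ^ 3) ^ 3 * t ^ 2 := by ring
    _ ≤ (b ^ n / (n ^ 2 * 2 ^ n)) ^ 3 * (1 / 16) ^ 2 := by gcongr
    _ ≤ (b ^ n / (n ^ 2 * 2 ^ n)) ^ 3 / 32 := by
      rw [div_eq_mul_one_div _ (32 : ℝ)]
      gcongr
      norm_num

section IndepSum

variable {V : Type u} (G : SimpleGraph V)

open Classical in
/-- The independent sets of `G` contained in `A`, that is, those of the induced subgraph `G[A]`.
Induced subgraphs are represented by their vertex sets, so that no change of vertex type is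
needed when vertices are deleted. -/
noncomputable def indepSetsIn (A : Finset V) : Finset (Finset V) :=
  {s ∈ A.powerset | G.IsIndepSet s}

/-- The independence polynomial `I(G[A], z)` of an induced subgraph, as a function of `z`. -/
noncomputable def indepSum {R : Type*} [CommRing R] (A : Finset V) (z : R) : R :=
  ∑ s ∈ indepSetsIn G A, (-z) ^ s.card

open Classical in
/-- The vertices of `A` outside the closed neighbourhood of `v`, written `A \ N[v]` on paper. -/
noncomputable def nonNbrs (A : Finset V) (v : V) : Finset V :=
  {u ∈ A | u ≠ v ∧ ¬ G.Adj v u}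

variable {G}

@[simp]
theorem mem_indepSetsIn {A s : Finset V} : s ∈ indepSetsIn G A ↔ s ⊆ A ∧ G.IsIndepSet s := by
  simp [indepSetsIn]

@[simp]
theorem mem_nonNbrs {A : Finset V} {v u : V} :
    u ∈ nonNbrs G A v ↔ u ∈ A ∧ u ≠ v ∧ ¬ G.Adj v u := by
  simp [nonNbrs]

variable (G)

theorem card_indepSetsIn_le (A : Finset V) : (indepSetsIn G A).card ≤ 2 ^ A.card := by
  rw [← Finset.card_powerset]
  exact Finset.card_le_card fun s hs => Finset.mem_powerset.2 (mem_indepSetsIn.1 hs).1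

theorem nonNbrs_subset (A : Finset V) (v : V) : nonNbrs G A v ⊆ A :=
  fun _ hu => (mem_nonNbrs.1 hu).1

theorem nonNbrs_subset_erase [DecidableEq V] (A : Finset V) (v : V) :
    nonNbrs G A v ⊆ A.erase v :=
  Finset.subset_erase.2 ⟨nonNbrs_subset G A v, fun h => (mem_nonNbrs.1 h).2.1 rfl⟩

variable {G} in
theorem insert_mem_indepSetsIn_iff [DecidableEq V] {A s : Finset V} {v : V} (hv : v ∈ A)
    (hvs : v ∉ s) : insert v s ∈ indepSetsIn G A ↔ s ∈ indepSetsIn G (nonNbrs G A v) := by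
  simp only [mem_indepSetsIn, Finset.coe_insert,
    Set.pairwise_insert_of_notMem (Finset.mem_coe.not.2 hvs), Finset.subset_iff, mem_nonNbrs,
    G.adj_comm _ v, and_self, Finset.mem_coe]
  grind

theorem indepSum_eq_erase_sub [DecidableEq V] {R : Type*} [CommRing R] {A : Finset V} {v : V}
    (hv : v ∈ A) (z : R) :
    indepSum G A z = indepSum G (A.erase v) z - z * indepSum G (nonNbrs G A v) z := by
  have hnotMem : ∀ s ∈ indepSetsIn G (nonNbrs G A v), v ∉ s := fun s hs hvs =>
    (mem_nonNbrs.1 ((mem_indepSetsIn.1 hs).1 hvs)).2.1 rfl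
  have without : {s ∈ indepSetsIn G A | v ∉ s} = indepSetsIn G (A.erase v) := by
    ext s
    simp only [Finset.mem_filter, mem_indepSetsIn, Finset.subset_erase]
    tauto
  have containing : {s ∈ indepSetsIn G A | ¬ v ∉ s} =
      (indepSetsIn G (nonNbrs G A v)).image (insert v) := by
    ext s
    simp only [Finset.mem_filter, not_not, Finset.mem_image]
    constructor
    · rintro ⟨hs, hvs⟩
      refine ⟨s.erase v, ?_, Finset.insert_erase hvs⟩
      rwa [← insert_mem_indepSetsIn_iff hv (Finset.notMem_erase v s), Finset.insert_erase hvs]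
    · rintro ⟨s, hs, rfl⟩
      exact ⟨(insert_mem_indepSetsIn_iff hv (hnotMem s hs)).2 hs, Finset.mem_insert_self v s⟩
  have hinj : Set.InjOn (insert v) (indepSetsIn G (nonNbrs G A v) : Set (Finset V)) :=
    fun s hs t ht hst => by
      rw [← Finset.erase_insert (hnotMem s hs), hst, Finset.erase_insert (hnotMem t ht)]
  rw [indepSum, ← Finset.sum_filter_add_sum_filter_not _ (v ∉ ·), without, containing,
    Finset.sum_image hinj, sub_eq_add_neg, indepSum, indepSum, Finset.mul_sum,
    ← Finset.sum_neg_distrib]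
  congr 1
  refine Finset.sum_congr rfl fun s hs => ?_
  rw [Finset.card_insert_of_notMem (hnotMem s hs), pow_succ]
  ring

section CommRing

variable {R : Type*} [CommRing R] (z : R)

@[simp]
theorem indepSum_empty : indepSum G ∅ z = 1 := by
  simp [indepSum, indepSetsIn, Finset.filter_singleton]

@[simp]
theorem indepSum_singleton (v : V) : indepSum G {v} z = 1 - z := by
  classical
  have hN : nonNbrs G {v} v = ∅ := by
    ext u
    simp only [mem_nonNbrs, Finset.mem_singleton, Finset.notMem_empty, iff_false]
    tauto
  rw [indepSum_eq_erase_sub G (Finset.mem_singleton_self v), hN]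
  simp

variable {G} in
theorem indepSum_pair [DecidableEq V] {u v : V} (h : G.Adj v u) :
    indepSum G {v, u} z = 1 - 2 * z := by
  have hE : ({v, u} : Finset V).erase v = {u} :=
    Finset.erase_insert (Finset.notMem_singleton.2 h.ne)
  have hN : nonNbrs G {v, u} v = ∅ := by
    ext w
    simp only [mem_nonNbrs, Finset.mem_insert, Finset.mem_singleton, Finset.notMem_empty]
    grind
  rw [indepSum_eq_erase_sub G (Finset.mem_insert_self v _), hE, hN, indepSum_singleton,
    indepSum_empty]
  ring

theorem aeval_indepPoly [Fintype V] : aeval z G.indepPoly = indepSum G Finset.univ z := by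
  have hcard (k : ℕ) : G.numIndepSets k =
      {s ∈ indepSetsIn G Finset.univ | s.card = k}.card := by
    rw [SimpleGraph.numIndepSets, ← Set.ncard_coe_finset]
    congr 1
    ext s
    simp [SimpleGraph.isNIndepSet_iff]
  have hmaps : ∀ s ∈ indepSetsIn G Finset.univ, s.card ∈ Finset.range (Fintype.card V + 1) :=
    fun s _ => Finset.mem_range_succ_iff.2 s.card_le_univ
  rw [SimpleGraph.indepPoly, map_sum, indepSum, ← Finset.sum_fiberwise_of_maps_to hmaps]
  refine Finset.sum_congr rfl fun k _ => ?_
  rw [Finset.sum_congr rfl fun s hs => by rw [(Finset.mem_filter.1 hs).2], Finset.sum_const,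
    ← hcard, nsmul_eq_mul]
  simp only [neg_pow z k, eq_intCast, Int.cast_neg, Int.cast_one, map_mul, map_pow, aeval_neg,
    map_one, map_natCast, aeval_X]
  ring

end CommRing

@[norm_cast]
theorem ofReal_indepSum (A : Finset V) (x : ℝ) :
    ((indepSum G A x : ℝ) : ℂ) = indepSum G A (x : ℂ) := by
  simp [indepSum]

theorem continuous_indepSum {R : Type*} [CommRing R] [TopologicalSpace R] [IsTopologicalRing R]
    (A : Finset V) : Continuous fun x : R => indepSum G A x := by
  unfold indepSum
  fun_prop

theorem indepSum_pos_of_nonpos {R : Type*} [CommRing R] [LinearOrder R] [IsStrictOrderedRing R]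
    (A : Finset V) {x : R} (hx : x ≤ 0) : 0 < indepSum G A x :=
  Finset.sum_pos' (fun _ _ => pow_nonneg (neg_nonneg.2 hx) _) ⟨∅, by simp, by simp⟩

/-! ### Quantitative bounds on the unit disc -/

variable {G} in
theorem norm_sum_indepSetsIn_le {E : Type*} [SeminormedAddCommGroup E] {A : Finset V}
    {f : Finset V → E} {K : ℝ} (hf : ∀ s ⊆ A, ‖f s‖ ≤ K) :
    ‖∑ s ∈ indepSetsIn G A, f s‖ ≤ 2 ^ A.card * K := by
  have hK : 0 ≤ K := (norm_nonneg _).trans (hf ∅ A.empty_subset)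
  calc ‖∑ s ∈ indepSetsIn G A, f s‖ ≤ ∑ _s ∈ indepSetsIn G A, K :=
        norm_sum_le_of_le _ fun s hs => hf s (mem_indepSetsIn.1 hs).1
    _ = (indepSetsIn G A).card * K := by rw [Finset.sum_const, nsmul_eq_mul]
    _ ≤ 2 ^ A.card * K := by
      gcongr
      exact_mod_cast card_indepSetsIn_le G A

theorem norm_indepSum_sub_le {R : Type*} [SeminormedCommRing R] [NormOneClass R] (A : Finset V)
    {z w : R} (hz : ‖z‖ ≤ 1) (hw : ‖w‖ ≤ 1) :
    ‖indepSum G A z - indepSum G A w‖ ≤ 2 ^ A.card * (A.card * ‖z - w‖) := by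
  rw [indepSum, indepSum, ← Finset.sum_sub_distrib]
  refine norm_sum_indepSetsIn_le fun s hs => ?_
  calc ‖(-z) ^ s.card - (-w) ^ s.card‖ ≤ s.card * ‖-z - -w‖ :=
        norm_pow_sub_pow_le (by rwa [norm_neg]) (by rwa [norm_neg]) _
    _ ≤ A.card * ‖z - w‖ := by
      rw [neg_sub_neg, norm_sub_rev]
      gcongr

theorem norm_indepSum_three_point_le {R : Type*} [SeminormedCommRing R] [NormOneClass R]
    (A : Finset V) {a b c : R} (ha : ‖a‖ ≤ 1) (hb : ‖b‖ ≤ 1) (hc : ‖c‖ ≤ 1) :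
    ‖(indepSum G A a - indepSum G A c) * (b - c) - (indepSum G A b - indepSum G A c) * (a - c)‖ ≤
      2 ^ A.card * (A.card ^ 2 * (‖a - b‖ * ‖a - c‖ * ‖b - c‖)) := by
  have hsum : (indepSum G A a - indepSum G A c) * (b - c) -
      (indepSum G A b - indepSum G A c) * (a - c) =
      ∑ s ∈ indepSetsIn G A, (((-b) ^ s.card - (-c) ^ s.card) * (-a - -c) -
        ((-a) ^ s.card - (-c) ^ s.card) * (-b - -c)) := by
    simp only [indepSum, Finset.sum_sub_distrib, ← Finset.sum_mul]
    ring
  rw [hsum]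
  refine norm_sum_indepSetsIn_le fun s hs => ?_
  refine (norm_pow_three_point_le (by rwa [norm_neg]) (by rwa [norm_neg]) (by rwa [norm_neg])
    _).trans ?_
  simp only [neg_sub_neg, norm_sub_rev c, norm_sub_rev a b]
  have : (s.card : ℝ) ≤ A.card := by exact_mod_cast Finset.card_le_card hs
  rw [mul_right_comm ‖b - a‖]
  gcongr

variable {G} in
theorem norm_indepSum_le_of_two_roots {𝕜 : Type*} [NormedField 𝕜] {A : Finset V} {a b c : 𝕜}
    (ha : ‖a‖ ≤ 1) (hb : ‖b‖ ≤ 1) (hc : ‖c‖ ≤ 1) (hac : a ≠ c) (ha0 : indepSum G A a = 0)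
    (hc0 : indepSum G A c = 0) :
    ‖indepSum G A b‖ ≤ A.card ^ 2 * 2 ^ A.card * (‖a - b‖ * ‖b - c‖) := by
  have h := norm_indepSum_three_point_le G A ha hb hc
  rw [ha0, hc0, sub_zero, sub_zero, zero_mul, zero_sub, norm_neg, norm_mul] at h
  refine le_of_mul_le_mul_right (h.trans_eq ?_) (norm_pos_iff.2 (sub_ne_zero.2 hac))
  ring

/-! ### Ratios in the Shearer region -/

/-- `r` lies in the Shearer region of `G[A]`: the independence polynomials of all induced subgraphs
of `G[A]` are positive at `r`. This is the region of parameters of the Lovász local lemma on which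
ratios of independence polynomials are controlled. -/
def InShearerRegion (A : Finset V) (r : ℝ) : Prop :=
  ∀ B ⊆ A, 0 < indepSum G B r

variable {G} {A B : Finset V} {r : ℝ}

theorem InShearerRegion.mono (h : InShearerRegion G A r) (hBA : B ⊆ A) : InShearerRegion G B r :=
  fun C hC => h C (hC.trans hBA)

theorem InShearerRegion.indepSum_pos (h : InShearerRegion G A r) : 0 < indepSum G A r :=
  h A subset_rfl

section Ratio

variable {𝕜 : Type*} [NormedField 𝕜] {z : 𝕜} {v : V}

theorem indepSum_eq_erase_mul [DecidableEq V] (hv : v ∈ A) (hz : indepSum G (A.erase v) z ≠ 0) :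
    indepSum G A z =
      indepSum G (A.erase v) z *
        (1 - z * (indepSum G (nonNbrs G A v) z / indepSum G (A.erase v) z)) := by
  rw [indepSum_eq_erase_sub G hv]
  field_simp

theorem indepSum_ne_zero_and_erase_div_bound [DecidableEq V] (hv : v ∈ A) (hz : ‖z‖ ≤ r)
    (hA : 0 < indepSum G A r) (hAv : 0 < indepSum G (A.erase v) r)
    (h0 : indepSum G (A.erase v) z ≠ 0)
    (hN : ‖indepSum G (nonNbrs G A v) z / indepSum G (A.erase v) z - 1‖ ≤
      indepSum G (nonNbrs G A v) r / indepSum G (A.erase v) r - 1) :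
    indepSum G A z ≠ 0 ∧
      ‖indepSum G (A.erase v) z / indepSum G A z - 1‖ ≤
        indepSum G (A.erase v) r / indepSum G A r - 1 := by
  have hle : ‖z * (indepSum G (nonNbrs G A v) z / indepSum G (A.erase v) z)‖ ≤
      r * (indepSum G (nonNbrs G A v) r / indepSum G (A.erase v) r) := by
    rw [norm_mul]
    exact mul_le_mul hz (norm_le_of_norm_sub_one_le hN) (norm_nonneg _) ((norm_nonneg z).trans hz)
  have hlt : r * (indepSum G (nonNbrs G A v) r / indepSum G (A.erase v) r) < 1 := by
    rw [indepSum_eq_erase_mul hv hAv.ne'] at hA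
    exact sub_pos.1 (pos_of_mul_pos_right hA hAv.le)
  rw [indepSum_eq_erase_mul hv h0, indepSum_eq_erase_mul hv hAv.ne', div_mul_cancel_left₀ h0,
    div_mul_cancel_left₀ hAv.ne']
  exact ⟨mul_ne_zero h0 (one_sub_ne_zero_of_norm_le hle hlt),
    norm_inv_one_sub_sub_one_le hle hlt⟩

theorem InShearerRegion.ne_zero_and_norm_div_sub_one_le (hA : InShearerRegion G A r)
    (hz : ‖z‖ ≤ r) :
    indepSum G A z ≠ 0 ∧ ∀ B ⊆ A,
      ‖indepSum G B z / indepSum G A z - 1‖ ≤ indepSum G B r / indepSum G A r - 1 := by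
  classical
  induction A using Finset.strongInduction with
  | H A ih =>
  have key : ∀ v ∈ A, indepSum G A z ≠ 0 ∧ ∀ B ⊆ A.erase v,
      ‖indepSum G B z / indepSum G A z - 1‖ ≤ indepSum G B r / indepSum G A r - 1 := by
    intro v hv
    have hAv := hA.mono (A.erase_subset v)
    obtain ⟨h0, hratio⟩ := ih _ (Finset.erase_ssubset hv) hAv
    obtain ⟨hne, herase⟩ := indepSum_ne_zero_and_erase_div_bound hv hz hA.indepSum_pos
      hAv.indepSum_pos h0 (hratio _ (nonNbrs_subset_erase G A v))
    refine ⟨hne, fun B hB => ?_⟩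
    rw [← div_mul_div_cancel₀ h0, ← div_mul_div_cancel₀ hAv.indepSum_pos.ne']
    exact norm_mul_sub_one_le (hratio B hB) herase
  have hne : indepSum G A z ≠ 0 := by
    rcases A.eq_empty_or_nonempty with rfl | ⟨v, hv⟩
    · simp
    · exact (key v hv).1
  refine ⟨hne, fun B hB => ?_⟩
  rcases hB.eq_or_ssubset with rfl | hB
  · rw [div_self hne, div_self hA.indepSum_pos.ne']
    simp
  · obtain ⟨v, hv, hvB⟩ := Finset.exists_of_ssubset hB
    exact (key v hv).2 B (Finset.subset_erase.2 ⟨hB.subset, hvB⟩)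

theorem InShearerRegion.indepSum_ne_zero (hA : InShearerRegion G A r) (hz : ‖z‖ ≤ r) :
    indepSum G A z ≠ 0 :=
  (hA.ne_zero_and_norm_div_sub_one_le hz).1

theorem InShearerRegion.norm_div_sub_one_le (hA : InShearerRegion G A r) (hz : ‖z‖ ≤ r)
    (hB : B ⊆ A) :
    ‖indepSum G B z / indepSum G A z - 1‖ ≤ indepSum G B r / indepSum G A r - 1 :=
  (hA.ne_zero_and_norm_div_sub_one_le hz).2 B hB

theorem InShearerRegion.div_le_div {s : ℝ} (hA : InShearerRegion G A r) (hs : 0 ≤ s)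
    (hsr : s ≤ r) (hB : B ⊆ A) :
    indepSum G B s / indepSum G A s ≤ indepSum G B r / indepSum G A r :=
  (le_abs_self _).trans <| norm_le_of_norm_sub_one_le <|
    hA.norm_div_sub_one_le ((Real.norm_of_nonneg hs).trans_le hsr) hB

theorem indepSum_div_sub_one_sub_eq [DecidableEq V] (hv : v ∈ A) (hA : indepSum G A z ≠ 0)
    (hAv : indepSum G (A.erase v) z ≠ 0) :
    indepSum G B z / indepSum G A z - 1 - z =
      (indepSum G B z / indepSum G (A.erase v) z - 1) *
          (indepSum G (A.erase v) z / indepSum G A z) +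
        z * (indepSum G (nonNbrs G A v) z / indepSum G A z - 1) := by
  field_simp
  rw [indepSum_eq_erase_sub G hv]
  ring

/-- The power series `I(G[B], z) / I(G[A], z)` has linear coefficient `|A \ B| ≥ 1`, so that `1 + z`
can be split off while keeping nonnegative coefficients. -/
theorem InShearerRegion.norm_div_sub_one_sub_le [DecidableEq V]
    (hA : InShearerRegion G A r) (hz : ‖z‖ ≤ r) (hv : v ∈ A) (hB : B ⊆ A.erase v) :
    ‖indepSum G B z / indepSum G A z - 1 - z‖ ≤ indepSum G B r / indepSum G A r - 1 - r := by
  have hAv := hA.mono (A.erase_subset v)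
  have hr : 0 ≤ r := (norm_nonneg z).trans hz
  rw [indepSum_div_sub_one_sub_eq hv (hA.indepSum_ne_zero hz) (hAv.indepSum_ne_zero hz),
    indepSum_div_sub_one_sub_eq hv hA.indepSum_pos.ne' hAv.indepSum_pos.ne']
  refine (norm_add_le _ _).trans (add_le_add ?_ ?_)
  · have hBv := hAv.norm_div_sub_one_le hz hB
    rw [norm_mul]
    exact mul_le_mul hBv
      (norm_le_of_norm_sub_one_le (hA.norm_div_sub_one_le hz (A.erase_subset v)))
      (norm_nonneg _) ((norm_nonneg _).trans hBv)
  · rw [norm_mul]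
    exact mul_le_mul hz (hA.norm_div_sub_one_le hz (nonNbrs_subset G A v)) (norm_nonneg _) hr

theorem indepSum_eq_zero_iff_mul_div_eq_one [DecidableEq V] (hv : v ∈ A)
    (h0 : indepSum G (A.erase v) z ≠ 0) :
    indepSum G A z = 0 ↔
      z * (indepSum G (nonNbrs G A v) z / indepSum G (A.erase v) z) = 1 := by
  rw [indepSum_eq_erase_mul hv h0, mul_eq_zero, or_iff_right h0, sub_eq_zero, eq_comm]

theorem InShearerRegion.mul_sub_le_indepSum [DecidableEq V] {x s : ℝ}
    (hx : InShearerRegion G (A.erase v) x)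
    (hv : v ∈ A) (hx1 : x ≤ 1) (hroot : indepSum G A x = 0) (hs : 0 ≤ s) (hsx : s ≤ x)
    (hpos : 0 < indepSum G (A.erase v) s) :
    indepSum G (A.erase v) x * (x - s) ≤ indepSum G A s := by
  have hone := (indepSum_eq_zero_iff_mul_div_eq_one hv hx.indepSum_pos.ne').1 hroot
  have hdecr : indepSum G (A.erase v) x ≤ indepSum G (A.erase v) s := by
    have := hx.div_le_div hs hsx (Finset.empty_subset _)
    rwa [indepSum_empty, indepSum_empty, div_le_div_iff_of_pos_left one_pos hpos hx.indepSum_pos]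
      at this
  set ρ := indepSum G (nonNbrs G A v) x / indepSum G (A.erase v) x
  have hx0 : 0 < x := (hs.trans hsx).lt_of_ne' (left_ne_zero_of_mul_eq_one hone)
  have hρ : 1 ≤ ρ := (eq_inv_of_mul_eq_one_right hone).symm ▸ (one_le_inv₀ hx0).2 hx1
  calc indepSum G (A.erase v) x * (x - s) ≤ indepSum G (A.erase v) s * (ρ * (x - s)) := by
        gcongr
        exact le_mul_of_one_le_left (sub_nonneg.2 hsx) hρ
    _ = indepSum G (A.erase v) s * (1 - s * ρ) := by rw [mul_sub, mul_comm ρ x, hone, mul_comm ρ]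
    _ ≤ indepSum G (A.erase v) s *
        (1 - s * (indepSum G (nonNbrs G A v) s / indepSum G (A.erase v) s)) := by
      gcongr
      exact hx.div_le_div hs hsx (nonNbrs_subset_erase G A v)
    _ = indepSum G A s := (indepSum_eq_erase_mul hv hpos.ne').symm

end Ratio

theorem indepSum_norm_add_le_zero [DecidableEq V] {u v : V} {z : ℂ} (hvA : v ∈ A) (huA : u ∈ A)
    (hvu : G.Adj v u) (hz : InShearerRegion G (A.erase v) ‖z‖) (hroot : indepSum G A z = 0) :
    indepSum G A ‖z‖ +
      indepSum G (A.erase v) ‖z‖ * (‖z - ‖z‖‖ ^ 2 / (2 * (1 + ‖z‖))) ≤ 0 := by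
  have hone := (indepSum_eq_zero_iff_mul_div_eq_one hvA (hz.indepSum_ne_zero le_rfl)).1 hroot
  have hNu : nonNbrs G A v ⊆ (A.erase v).erase u :=
    Finset.subset_erase.2 ⟨nonNbrs_subset_erase G A v, fun h => (mem_nonNbrs.1 h).2.2 hvu⟩
  have hsplit := hz.norm_div_sub_one_sub_le le_rfl (Finset.mem_erase.2 ⟨hvu.ne', huA⟩) hNu
  set q := indepSum G (nonNbrs G A v) z / indepSum G (A.erase v) z
  set ρ := indepSum G (nonNbrs G A v) ‖z‖ / indepSum G (A.erase v) ‖z‖ with hρ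
  have htriangle : 1 ≤ ‖z‖ * ‖1 + z‖ + ‖z‖ * (ρ - 1 - ‖z‖) :=
    calc (1 : ℝ) = ‖z * (1 + z) + z * (q - 1 - z)‖ := by
          rw [← norm_one (α := ℂ), ← hone]; congr 1; ring
      _ ≤ ‖z‖ * ‖1 + z‖ + ‖z‖ * ‖q - 1 - z‖ := by
        simpa only [norm_mul] using norm_add_le (z * (1 + z)) (z * (q - 1 - z))
      _ ≤ ‖z‖ * ‖1 + z‖ + ‖z‖ * (ρ - 1 - ‖z‖) := by gcongr
  have hgap : 1 - ‖z‖ * ρ + ‖z - ‖z‖‖ ^ 2 / (2 * (1 + ‖z‖)) ≤ 0 := by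
    linarith [norm_sub_norm_sq_div_le z]
  rw [indepSum_eq_erase_mul hvA hz.indepSum_pos.ne', ← hρ, ← mul_add]
  exact mul_nonpos_of_nonneg_of_nonpos hz.indepSum_pos.le hgap

/-! ### First zeros on the positive axis -/

theorem indepSum_le_of_subset {x : ℝ} (hx : 0 ≤ x) (hA : ∀ B ⊆ A, 0 ≤ indepSum G B x)
    (hBA : B ⊆ A) : indepSum G A x ≤ indepSum G B x := by
  classical
  induction A using Finset.strongInduction with
  | H A ih =>
  rcases hBA.eq_or_ssubset with rfl | hlt
  · rfl
  · obtain ⟨v, hv, hvB⟩ := Finset.exists_of_ssubset hlt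
    calc indepSum G A x ≤ indepSum G (A.erase v) x := by
          rw [indepSum_eq_erase_sub G hv]
          exact sub_le_self _ (mul_nonneg hx (hA _ (nonNbrs_subset G A v)))
      _ ≤ indepSum G B x :=
        ih _ (Finset.erase_ssubset hv) (fun C hC => hA C (hC.trans (A.erase_subset v)))
          (Finset.subset_erase.2 ⟨hBA, hvB⟩)

theorem InShearerRegion.indepSum_nonneg_of_forall_lt {x : ℝ}
    (h : ∀ s < x, InShearerRegion G A s) (hBA : B ⊆ A) : 0 ≤ indepSum G B x :=
  nonneg_of_continuous_of_forall_lt (continuous_indepSum G B) fun s hs => h s hs B hBA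

theorem inShearerRegion_of_forall_lt {x : ℝ} (h : ∀ s < x, 0 < indepSum G A s) :
    ∀ s < x, InShearerRegion G A s := by
  classical
  induction A using Finset.strongInduction generalizing x with
  | H A ih =>
  have herase : ∀ v ∈ A, ∀ s < x, 0 < indepSum G (A.erase v) s := by
    intro v hv s hs
    by_contra! hneg
    obtain ⟨m, hm, hm0, hmpos⟩ := exists_first_zero_of_continuous
      (continuous_indepSum G (A.erase v)) (fun _ => indepSum_pos_of_nonpos G _) hneg
    have hN : 0 ≤ indepSum G (nonNbrs G A v) m :=
      InShearerRegion.indepSum_nonneg_of_forall_lt (ih _ (Finset.erase_ssubset hv) hmpos)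
        (nonNbrs_subset_erase G A v)
    refine (h m (hm.2.trans_lt hs)).not_ge ?_
    rw [indepSum_eq_erase_sub G hv, hm0, zero_sub]
    exact neg_nonpos.2 (mul_nonneg hm.1.le hN)
  intro s hs B hBA
  rcases hBA.eq_or_ssubset with rfl | hlt
  · exact h s hs
  · obtain ⟨v, hv, hvB⟩ := Finset.exists_of_ssubset hlt
    exact ih _ (Finset.erase_ssubset hv) (herase v hv) s hs B (Finset.subset_erase.2 ⟨hBA, hvB⟩)

theorem exists_first_zero_indepSum_of_subset (hBA : B ⊆ A) {t : ℝ} (ht : indepSum G B t ≤ 0) :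
    ∃ m ∈ Set.Ioc 0 t, indepSum G A m = 0 ∧ ∀ s < m, 0 < indepSum G A s := by
  have ht0 : 0 ≤ t := le_of_not_ge fun h => (indepSum_pos_of_nonpos G B h).not_ge ht
  obtain ⟨s, hst, hs⟩ : ∃ s ≤ t, indepSum G A s ≤ 0 := by
    by_contra! hpos
    have hnonneg : ∀ C ⊆ A, 0 ≤ indepSum G C t := fun C =>
      InShearerRegion.indepSum_nonneg_of_forall_lt <|
        inShearerRegion_of_forall_lt fun s hs => hpos s hs.le
    exact (hpos t le_rfl).not_ge ((indepSum_le_of_subset ht0 hnonneg hBA).trans ht)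
  obtain ⟨m, hm, hzero⟩ := exists_first_zero_of_continuous (continuous_indepSum G A)
    (fun _ => indepSum_pos_of_nonpos G A) hs
  exact ⟨m, ⟨hm.1, hm.2.trans hst⟩, hzero⟩

theorem exists_adj_boundary_of_preconnected (hG : G.Preconnected) (hA : A.Nonempty) {w : V}
    (hw : w ∉ A) : ∃ u ∈ A, ∃ p ∉ A, G.Adj p u := by
  obtain ⟨a, ha⟩ := hA
  obtain ⟨walk⟩ := hG a w
  obtain ⟨d, -, hfst, hsnd⟩ := walk.exists_boundary_dart (A : Set V) ha hw
  exact ⟨d.fst, hfst, d.snd, hsnd, d.adj.symm⟩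

theorem pow_card_le_indepSum (hG : G.Preconnected) {x : ℝ} (hx : 0 ≤ x)
    (hpos : ∀ B, 0 ≤ indepSum G B x) {w : V} (hw : w ∉ A) : x ^ A.card ≤ indepSum G A x := by
  classical
  induction A using Finset.strongInduction with
  | H A ih =>
  rcases A.eq_empty_or_nonempty with rfl | hne
  · simp
  obtain ⟨u, hu, p, hp, hpu⟩ := exists_adj_boundary_of_preconnected hG hne hw
  have hsub : nonNbrs G (insert p A) p ⊆ A.erase u := by
    intro y hy
    obtain ⟨hyA, hyp, hnadj⟩ := mem_nonNbrs.1 hy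
    exact Finset.mem_erase.2
      ⟨fun h => hnadj (h ▸ hpu), (Finset.mem_insert.1 hyA).resolve_left hyp⟩
  calc x ^ A.card = x * x ^ (A.erase u).card := by
        rw [← pow_succ', Finset.card_erase_add_one hu]
    _ ≤ x * indepSum G (A.erase u) x := by
      gcongr
      exact ih _ (Finset.erase_ssubset hu) fun h => hw (Finset.mem_of_mem_erase h)
    _ ≤ x * indepSum G (nonNbrs G (insert p A) p) x := by
      gcongr
      exact indepSum_le_of_subset hx (fun B _ => hpos B) hsub
    _ ≤ indepSum G A x := by
      have hinsert := hpos (insert p A)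
      rwa [indepSum_eq_erase_sub G (Finset.mem_insert_self p A), Finset.erase_insert hp,
        sub_nonneg] at hinsert

end IndepSum

section SmallestRoot

/-! ### The smallest root -/

variable {V : Type u} [Fintype V] {G : SimpleGraph V} {B : Finset V} {v : V} {z : ℂ}

theorem smallestRoot_first_zero_of_indepSum_nonpos {t : ℝ} (ht : indepSum G B t ≤ 0) :
    G.smallestRoot ∈ Set.Ioc 0 t ∧ indepSum G Finset.univ G.smallestRoot = 0 ∧
      ∀ s < G.smallestRoot, 0 < indepSum G Finset.univ s := by
  obtain ⟨m, hm, hm0, hpos⟩ := exists_first_zero_indepSum_of_subset B.subset_univ ht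
  have hleast : IsLeast {x : ℝ | indepSum G Finset.univ x = 0} m :=
    ⟨hm0, fun x hx => le_of_not_gt fun h => (hpos x h).ne' hx⟩
  have hβ : G.smallestRoot = m := by
    simp only [SimpleGraph.smallestRoot, aeval_indepPoly]
    exact hleast.csInf_eq
  exact hβ ▸ ⟨hm, hm0, hpos⟩

theorem smallestRoot_le_half [Nontrivial V] (hG : G.Preconnected) : G.smallestRoot ≤ 1 / 2 := by
  classical
  obtain ⟨v⟩ := ‹Nontrivial V›.to_nonempty
  obtain ⟨u, hvu⟩ := hG.exists_adj_of_nontrivial v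
  have hedge : indepSum G {v, u} (1 / 2 : ℝ) ≤ 0 := by
    rw [indepSum_pair _ hvu]
    norm_num
  exact (smallestRoot_first_zero_of_indepSum_nonpos hedge).1.2

section Nonempty

variable [Nonempty V] (G)

theorem smallestRoot_first_zero :
    G.smallestRoot ∈ Set.Ioc 0 1 ∧ indepSum G Finset.univ G.smallestRoot = 0 ∧
      ∀ s < G.smallestRoot, 0 < indepSum G Finset.univ s := by
  obtain ⟨v⟩ := ‹Nonempty V›
  exact smallestRoot_first_zero_of_indepSum_nonpos (B := {v}) (by simp)

theorem smallestRoot_pos : 0 < G.smallestRoot :=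
  (smallestRoot_first_zero G).1.1

theorem smallestRoot_le_one : G.smallestRoot ≤ 1 :=
  (smallestRoot_first_zero G).1.2

theorem indepSum_smallestRoot : indepSum G Finset.univ G.smallestRoot = 0 :=
  (smallestRoot_first_zero G).2.1

theorem indepSum_ofReal_smallestRoot : indepSum G Finset.univ (G.smallestRoot : ℂ) = 0 := by
  exact_mod_cast indepSum_smallestRoot G

theorem isLeast_smallestRoot : IsLeast {x : ℝ | aeval x G.indepPoly = 0} G.smallestRoot := by
  simp only [aeval_indepPoly]
  exact ⟨indepSum_smallestRoot G, fun x hx =>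
    le_of_not_gt fun h => ((smallestRoot_first_zero G).2.2 x h).ne' hx⟩

variable {G}

theorem inShearerRegion_of_lt_smallestRoot {s : ℝ} (hs : s < G.smallestRoot) :
    InShearerRegion G Finset.univ s :=
  inShearerRegion_of_forall_lt (smallestRoot_first_zero G).2.2 s hs

theorem pow_smallestRoot_le_indepSum (hG : G.Preconnected) (hv : v ∉ B) :
    G.smallestRoot ^ Fintype.card V ≤ indepSum G B G.smallestRoot :=
  have hnonneg (C : Finset V) : 0 ≤ indepSum G C G.smallestRoot :=
    InShearerRegion.indepSum_nonneg_of_forall_lt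
      (fun _ => inShearerRegion_of_lt_smallestRoot) C.subset_univ
  (pow_le_pow_of_le_one (smallestRoot_pos G).le (smallestRoot_le_one G) B.card_le_univ).trans
    (pow_card_le_indepSum hG (smallestRoot_pos G).le hnonneg hv)

theorem inShearerRegion_smallestRoot (hG : G.Preconnected) (hv : v ∉ B) :
    InShearerRegion G B G.smallestRoot := fun _ hC =>
  (pow_pos (smallestRoot_pos G) _).trans_le (pow_smallestRoot_le_indepSum hG fun h => hv (hC h))

theorem pow_smallestRoot_mul_sub_le_indepSum (hG : G.Preconnected) {s : ℝ} (hs0 : 0 ≤ s)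
    (hs : s < G.smallestRoot) :
    G.smallestRoot ^ Fintype.card V * (G.smallestRoot - s) ≤ indepSum G Finset.univ s := by
  classical
  obtain ⟨v⟩ := ‹Nonempty V›
  have hv : v ∉ Finset.univ.erase v := Finset.notMem_erase v _
  calc G.smallestRoot ^ Fintype.card V * (G.smallestRoot - s)
      ≤ indepSum G (Finset.univ.erase v) G.smallestRoot * (G.smallestRoot - s) :=
        mul_le_mul_of_nonneg_right (pow_smallestRoot_le_indepSum hG hv) (sub_nonneg.2 hs.le)
    _ ≤ indepSum G Finset.univ s :=
        (inShearerRegion_smallestRoot hG hv).mul_sub_le_indepSum (Finset.mem_univ v)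
          (smallestRoot_le_one G) (indepSum_smallestRoot G) hs0 hs.le
          (inShearerRegion_of_lt_smallestRoot hs _ (Finset.subset_univ _))

end Nonempty

/-! ### Separation of the smallest root -/

variable (G) in
/-- The radius `β ^ n / (n ^ 2 * 2 ^ n)` within which `β = β(G)` is the only root of `I(G, z)` in
the unit disc: the derivative at `β` has modulus at least `β ^ n`, and second divided differences
are at most `n ^ 2 * 2 ^ n` on the unit disc. -/
noncomputable def rootSeparation : ℝ :=
  G.smallestRoot ^ Fintype.card V / (Fintype.card V ^ 2 * 2 ^ Fintype.card V)

theorem abs_indepSum_sub_le {x y : ℝ} (hx : |x| ≤ 1) (hy : |y| ≤ 1) :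
    |indepSum G B x - indepSum G B y| ≤
      Fintype.card V ^ 2 * 2 ^ Fintype.card V * |x - y| := by
  have hcard : B.card ≤ Fintype.card V := B.card_le_univ
  calc |indepSum G B x - indepSum G B y| ≤ 2 ^ B.card * (B.card * |x - y|) :=
        norm_indepSum_sub_le G B (R := ℝ) hx hy
    _ ≤ 2 ^ Fintype.card V * (Fintype.card V ^ 2 * |x - y|) := by
      gcongr
      · norm_num
      · exact_mod_cast hcard.trans (Nat.le_self_pow two_ne_zero _)
    _ = Fintype.card V ^ 2 * 2 ^ Fintype.card V * |x - y| := by ring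

section Nonempty

variable [Nonempty V]

variable (G) in
theorem rootSeparation_pos : 0 < rootSeparation G := by
  have := smallestRoot_pos G
  unfold rootSeparation
  positivity

variable (G) in
theorem mul_rootSeparation :
    Fintype.card V ^ 2 * 2 ^ Fintype.card V * rootSeparation G =
      G.smallestRoot ^ Fintype.card V :=
  mul_div_cancel₀ _ (by positivity)

variable (G) in
theorem rootSeparation_le_one : rootSeparation G ≤ 1 := by
  have hn : (1 : ℝ) ≤ Fintype.card V := by exact_mod_cast Fintype.card_pos (α := V)
  refine div_le_one_of_le₀ ?_ (by positivity)
  calc G.smallestRoot ^ Fintype.card V ≤ 1 * 1 := by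
        rw [one_mul]
        exact pow_le_one₀ (smallestRoot_pos G).le (smallestRoot_le_one G)
    _ ≤ (Fintype.card V : ℝ) ^ 2 * 2 ^ Fintype.card V := by
      gcongr
      · exact one_le_pow₀ hn
      · exact one_le_pow₀ one_le_two

theorem rootSeparation_le_norm_sub (hG : G.Preconnected) (hz : ‖z‖ ≤ 1)
    (hz0 : indepSum G Finset.univ z = 0) (hne : z ≠ G.smallestRoot) :
    rootSeparation G ≤ ‖z - G.smallestRoot‖ := by
  set β := G.smallestRoot
  have hβ : 0 < β := smallestRoot_pos G
  have hβ1 : β ≤ 1 := smallestRoot_le_one G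
  have hnear : ∀ s ∈ Set.Ioo 0 β, rootSeparation G ≤ ‖z - s‖ := by
    intro s ⟨hs0, hsβ⟩
    have hlow := pow_smallestRoot_mul_sub_le_indepSum hG hs0.le hsβ
    have hup := norm_indepSum_le_of_two_roots (b := (s : ℂ)) (c := β) hz
      (by rw [Complex.norm_of_nonneg hs0.le]; linarith)
      (by rwa [Complex.norm_of_nonneg hβ.le]) hne hz0 (indepSum_ofReal_smallestRoot G)
    rw [← ofReal_indepSum, ← Complex.ofReal_sub, Complex.norm_real, Complex.norm_real,
      norm_sub_rev s, Real.norm_of_nonneg (sub_nonneg.2 hsβ.le), ← mul_assoc] at hup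
    refine div_le_of_le_mul₀ (by positivity) (norm_nonneg _) ?_
    rw [mul_comm]
    exact le_of_mul_le_mul_right (hlow.trans ((le_abs_self _).trans hup)) (sub_pos.2 hsβ)
  have hlim : Filter.Tendsto (fun s : ℝ => ‖z - s‖) (nhdsWithin β (Set.Iio β))
      (nhds ‖z - β‖) := (Continuous.tendsto (by fun_prop) β).mono_left nhdsWithin_le_nhds
  exact ge_of_tendsto hlim (Filter.mem_of_superset (Ioo_mem_nhdsLT hβ) hnear)

theorem abs_indepSum_sub_smallestRoot_lt {s : ℝ} (hs : G.smallestRoot ≤ s) (hs1 : s ≤ 1)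
    (hlt : s < G.smallestRoot + rootSeparation G ^ 3 / 32) :
    |indepSum G B s - indepSum G B G.smallestRoot| <
      G.smallestRoot ^ Fintype.card V * rootSeparation G ^ 2 / 32 := by
  set β := G.smallestRoot
  set n := Fintype.card V
  set q := rootSeparation G
  have hβ : 0 < β := smallestRoot_pos G
  calc |indepSum G B s - indepSum G B β| ≤ n ^ 2 * 2 ^ n * |s - β| :=
        abs_indepSum_sub_le (abs_le.2 ⟨by linarith, hs1⟩) (abs_le.2 ⟨by linarith, by linarith⟩)
    _ < n ^ 2 * 2 ^ n * (q ^ 3 / 32) := by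
      rw [abs_of_nonneg (sub_nonneg.2 hs)]
      gcongr
      linarith
    _ = β ^ n * q ^ 2 / 32 := by
      rw [← mul_rootSeparation G]
      ring

theorem half_pow_smallestRoot_le_indepSum (hG : G.Preconnected) (hv : v ∉ B) {s : ℝ}
    (hs : G.smallestRoot ≤ s) (hs1 : s ≤ 1)
    (hlt : s < G.smallestRoot + rootSeparation G ^ 3 / 32) :
    G.smallestRoot ^ Fintype.card V / 2 ≤ indepSum G B s := by
  have hpow := pow_pos (smallestRoot_pos G) (Fintype.card V)
  have hat := pow_smallestRoot_le_indepSum hG hv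
  have hq : rootSeparation G ^ 2 ≤ 1 :=
    pow_le_one₀ (rootSeparation_pos G).le (rootSeparation_le_one G)
  have hdiff := (abs_lt.1 (abs_indepSum_sub_smallestRoot_lt (B := B) hs hs1 hlt)).1
  linarith [mul_le_of_le_one_right hpow.le hq]

end Nonempty

section Nontrivial

variable [Nontrivial V]

theorem smallestRoot_add_rootSeparation_le_one (hG : G.Preconnected) :
    G.smallestRoot + rootSeparation G ^ 3 / 32 ≤ 1 := by
  linarith [smallestRoot_le_half hG,
    pow_le_one₀ (n := 3) (rootSeparation_pos G).le (rootSeparation_le_one G)]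

theorem inShearerRegion_erase_of_lt [DecidableEq V] (hG : G.Preconnected) (v : V) {s : ℝ}
    (hs : s < G.smallestRoot + rootSeparation G ^ 3 / 32) :
    InShearerRegion G (Finset.univ.erase v) s := by
  refine inShearerRegion_of_forall_lt (fun t ht => ?_) s hs
  rcases lt_or_ge t G.smallestRoot with hβ | hβ
  · exact inShearerRegion_of_lt_smallestRoot hβ _ (Finset.subset_univ _)
  · exact (half_pos (pow_pos (smallestRoot_pos G) _)).trans_le <|
      half_pow_smallestRoot_le_indepSum hG (Finset.notMem_erase v _) hβ
        (ht.le.trans (smallestRoot_add_rootSeparation_le_one hG)) ht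

theorem rootSeparation_sq_div_le (hG : G.Preconnected)
    (hz0 : indepSum G Finset.univ z = 0) (hne : z ≠ G.smallestRoot)
    (hβz : G.smallestRoot ≤ ‖z‖) (hlt : ‖z‖ < G.smallestRoot + rootSeparation G ^ 3 / 32) :
    rootSeparation G ^ 2 / 16 ≤ ‖z - ‖z‖‖ ^ 2 / (2 * (1 + ‖z‖)) := by
  set q := rootSeparation G
  have hq : 0 < q := rootSeparation_pos G
  have hz1 : ‖z‖ ≤ 1 := hlt.le.trans (smallestRoot_add_rootSeparation_le_one hG)
  have hq3 : q ^ 3 ≤ q := pow_le_of_le_one hq.le (rootSeparation_le_one G) three_ne_zero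
  have hsep : q / 2 ≤ ‖z - ‖z‖‖ := by
    have htri := norm_sub_le_norm_sub_add_norm_sub z (‖z‖ : ℂ) (G.smallestRoot : ℂ)
    rw [← Complex.ofReal_sub, Complex.norm_real, Real.norm_of_nonneg (sub_nonneg.2 hβz)] at htri
    linarith [rootSeparation_le_norm_sub hG hz1 hz0 hne]
  calc q ^ 2 / 16 = (q / 2) ^ 2 / (2 * (1 + 1)) := by ring
    _ ≤ ‖z - ‖z‖‖ ^ 2 / (2 * (1 + ‖z‖)) := by gcongr

theorem smallestRoot_add_rootSeparation_le_norm (hG : G.Preconnected)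
    (hz0 : indepSum G Finset.univ z = 0) (hne : z ≠ G.smallestRoot) :
    G.smallestRoot + rootSeparation G ^ 3 / 32 ≤ ‖z‖ := by
  classical
  by_contra! hlt
  obtain ⟨v⟩ := ‹Nontrivial V›.to_nonempty
  obtain ⟨u, hvu⟩ := hG.exists_adj_of_nontrivial v
  have hz1 : ‖z‖ ≤ 1 := hlt.le.trans (smallestRoot_add_rootSeparation_le_one hG)
  have hregion := inShearerRegion_erase_of_lt hG v hlt
  have hgap := indepSum_norm_add_le_zero (Finset.mem_univ v) (Finset.mem_univ u) hvu hregion hz0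
  have hβz : G.smallestRoot ≤ ‖z‖ := by
    by_contra! hzβ
    have := hregion.indepSum_pos
    have hquad : 0 ≤ indepSum G (Finset.univ.erase v) ‖z‖ *
      (‖z - ‖z‖‖ ^ 2 / (2 * (1 + ‖z‖))) := by positivity
    linarith [(inShearerRegion_of_lt_smallestRoot hzβ).indepSum_pos]
  have hquad := rootSeparation_sq_div_le hG hz0 hne hβz hlt
  have herase := half_pow_smallestRoot_le_indepSum hG (Finset.notMem_erase v Finset.univ)
    hβz hz1 hlt
  have := pow_pos (smallestRoot_pos G) (Fintype.card V)
  have hlow : G.smallestRoot ^ Fintype.card V / 2 * (rootSeparation G ^ 2 / 16) ≤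
      -indepSum G Finset.univ ‖z‖ :=
    (mul_le_mul herase hquad (by positivity) hregion.indepSum_pos.le).trans (by linarith)
  have hup := abs_indepSum_sub_smallestRoot_lt (B := Finset.univ) hβz hz1 hlt
  rw [indepSum_smallestRoot, sub_zero] at hup
  linarith [neg_le_abs (indepSum G Finset.univ ‖z‖)]

end Nontrivial

theorem smallestRoot_add_div_pow_le_norm (hG : G.Connected)
    (hz0 : indepSum G Finset.univ z = 0) (hne : z ≠ G.smallestRoot) :
    G.smallestRoot + (G.smallestRoot / Fintype.card V) ^ (11 * Fintype.card V) ≤ ‖z‖ := by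
  have := hG.nonempty
  rcases subsingleton_or_nontrivial V with hV | hV
  · obtain ⟨v⟩ := hG.nonempty
    have hβ := indepSum_ofReal_smallestRoot G
    rw [← Finset.singleton_eq_univ v, indepSum_singleton] at hz0 hβ
    exact absurd (sub_right_injective (hz0.trans hβ.symm)) hne
  · refine le_trans ?_ (smallestRoot_add_rootSeparation_le_norm hG.preconnected hz0 hne)
    gcongr
    exact div_pow_le_cube_div (smallestRoot_pos G).le (smallestRoot_le_half hG.preconnected)
      Fintype.one_lt_card

end SmallestRoot

/-- The exponent `O(n)` is `c * n`, with one constant `c` for all connected finite graphs. -/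
theorem mainTheorem1 :
    ∃ c : ℕ, ∀ (V : Type u) [Fintype V] (G : SimpleGraph V), G.Connected →
      IsLeast {x : ℝ | aeval x G.indepPoly = 0} G.smallestRoot ∧
      {z : ℂ | z ∈ Metric.ball (0 : ℂ)
          (G.smallestRoot + (G.smallestRoot / Fintype.card V) ^ (c * Fintype.card V)) ∧
        aeval z G.indepPoly = 0} = {(G.smallestRoot : ℂ)} := by
  refine ⟨11, fun V _ G hG => ?_⟩
  have := hG.nonempty
  have hβ := smallestRoot_pos G
  refine ⟨isLeast_smallestRoot G, Set.eq_singleton_iff_unique_mem.2 ⟨⟨?_, ?_⟩, ?_⟩⟩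
  · rw [mem_ball_zero_iff, Complex.norm_of_nonneg hβ.le]
    exact lt_add_of_pos_right _ (by positivity)
  · rw [aeval_indepPoly, indepSum_ofReal_smallestRoot]
  · rintro z ⟨hball, hz⟩
    by_contra hne
    rw [aeval_indepPoly] at hz
    exact (mem_ball_zero_iff.1 hball).not_ge (smallestRoot_add_div_pow_le_norm hG hz hne)
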